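/- Let $\omega=(\omega_j)_{j\ge 1}$ be a uniformly distributed sequence of points in $[0,1]$, i.e. for all $0\le a<b\le 1$, $$\lim_{N\to\infty}\frac{\#\{1\le j\le N:\ a\le \omega_j<b\}}{N}=b-a .$$ For $N\ge 1$ let $$D_N(\omega)=\sup_{0\le a<b\le 1}\left|\frac{\#\{1\le j\le N:\ a\le \omega_j<b\}}{N}-(b-a)\right|$$ be its discrepancy. Assume that there is a constant $C>0$ such that $D_N(\omega)\le C/N$ for infinitely many $N\in\mathbb N$. Let $\tau>1$ and $\psi(N)=N^{-\tau}$ for $N\ge1$. Then the set $$W_\omega(\psi)=\left\{x\in[0,1]:\ |x-\omega_j|<\psi(j)\ \text{ for infinitely many } j\ge 1\right\}$$ has Hausdorff dimension $$\dim_{\mathrm H} W_\omega(\psi)=\frac1\tau .$$ -/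

import Mathlib

open Set Filter Topology MeasureTheory

/-- `A(R; N, ω)`: the number of indices `1 ≤ j ≤ N` with `ω j ∈ R`. Sequences are indexed by
`j ≥ 1`; the value `ω 0` is never used in any of the definitions below. -/
noncomputable def countingFn (R : Set ℝ) (N : ℕ) (ω : ℕ → ℝ) : ℕ :=
  Set.ncard {j : ℕ | 1 ≤ j ∧ j ≤ N ∧ ω j ∈ R}

/-- The (one-dimensional) rectangles in `[0,1]`: the sets `{x ∈ [0,1] : a ≤ x < b}` with
`a, b ∈ [0,1]` and `a < b`. -/
def unitRectangles : Set (Set ℝ) :=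
  {R | ∃ a ∈ Icc (0 : ℝ) 1, ∃ b ∈ Icc (0 : ℝ) 1, a < b ∧ R = Ico a b}

/-- `ω = (ω j)_{j ≥ 1}` is a sequence of points of `[0,1]` that is uniformly distributed
on `[0,1]`. -/
structure IsUniformlyDistributed (ω : ℕ → ℝ) : Prop where
  mem_unit : ∀ j : ℕ, 1 ≤ j → ω j ∈ Icc (0 : ℝ) 1
  tendsto_freq : ∀ R ∈ unitRectangles,
    Tendsto (fun N : ℕ => (countingFn R N ω : ℝ) / (N : ℝ)) atTop (𝓝 (volume.real R))

/-- The discrepancy `D_N(ω)`: the supremum over all rectangles `R ⊆ [0,1]` of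
`|A(R; N, ω) / N - λ(R)|`. -/
noncomputable def discrepancy (ω : ℕ → ℝ) (N : ℕ) : ℝ :=
  sSup ((fun R : Set ℝ => |(countingFn R N ω : ℝ) / (N : ℝ) - volume.real R|) '' unitRectangles)

/-- `W_ω(ψ)`: the points `x ∈ [0,1]` with `|x - ω j| < ψ j` for infinitely many `j ≥ 1`. -/
def approxSet (ω : ℕ → ℝ) (ψ : ℕ → ℝ) : Set ℝ :=
  {x | x ∈ Icc (0 : ℝ) 1 ∧ {j : ℕ | 1 ≤ j ∧ |x - ω j| < ψ j}.Infinite}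

theorem countingFn_le (R : Set ℝ) (N : ℕ) (ω : ℕ → ℝ) : countingFn R N ω ≤ N := by
  have h : {j : ℕ | 1 ≤ j ∧ j ≤ N ∧ ω j ∈ R} ⊆ (Finset.Icc 1 N : Set ℕ) := by
    intro j hj
    simpa using ⟨hj.1, hj.2.1⟩
  have h2 := Set.ncard_le_ncard h (Finset.finite_toSet _)
  rw [Set.ncard_coe_finset] at h2
  simpa [countingFn] using h2

/-- The supremum that defines the discrepancy is one of a set that is bounded above by `1`. -/
theorem discrepancy_bddAbove (ω : ℕ → ℝ) (N : ℕ) :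
    BddAbove ((fun R : Set ℝ =>
      |(countingFn R N ω : ℝ) / (N : ℝ) - volume.real R|) '' unitRectangles) := by
  refine ⟨1, ?_⟩
  rintro _ ⟨_, ⟨a, ha, b, hb, hab, rfl⟩, rfl⟩
  have h1 : (countingFn (Ico a b) N ω : ℝ) / (N : ℝ) ≤ 1 :=
    div_le_one_of_le₀ (by exact_mod_cast countingFn_le _ _ _) (by positivity)
  have h2 : 0 ≤ (countingFn (Ico a b) N ω : ℝ) / (N : ℝ) := by positivity
  have h3 : volume.real (Ico a b) = b - a := Real.volume_real_Ico_of_le hab.le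
  simp only [h3]
  rw [abs_le]
  constructor <;> linarith [ha.1, ha.2, hb.1, hb.2]

/-! The upper bound is Borel–Cantelli: each tail of the balls covers the set, and the sum of their
diameters to the power `d` converges for `d > 1/τ`. For the lower bound, discrepancy `≤ C/N` forces
every interval of length slightly above `C/N` to contain one of `ω 1, …, ω N`. Along very sparse
such `N` this gives a Cantor set: inside an interval of length about `N^(-τ)`, cells of length about
`1/N'` each contain a sequence point, around which an interval of length about `N'^(-τ)` starts.
Mixed-radix digits of `y ∈ [0,1)` select the cells and give a map `y ↦ x y` into the Cantor set. Its
inverse is `s`-Hölder for each `s < 1/τ`, so the Cantor set has dimension at least `s`. -/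

/-! ### Cantor sets coded by mixed-radix digits -/

/-- The digit of `y` at level `k + 1` of the mixed-radix expansion with radices `m`. -/
noncomputable def mixedDigit (m : ℕ → ℕ) (k : ℕ) (y : ℝ) : ℤ :=
  ⌊(∏ i ∈ Finset.range (k + 1), (m i : ℝ)) * y⌋ -
    m k * ⌊(∏ i ∈ Finset.range k, (m i : ℝ)) * y⌋

theorem mixedDigit_nonneg (m : ℕ → ℕ) (k : ℕ) (y : ℝ) : 0 ≤ mixedDigit m k y := by
  rw [mixedDigit, sub_nonneg, Int.le_floor, Finset.prod_range_succ]
  push_cast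
  have := Int.floor_le ((∏ i ∈ Finset.range k, (m i : ℝ)) * y)
  nlinarith [Nat.cast_nonneg (α := ℝ) (m k)]

theorem mixedDigit_lt (m : ℕ → ℕ) (k : ℕ) (y : ℝ) (hm : 0 < m k) : mixedDigit m k y < m k := by
  rw [mixedDigit, sub_lt_iff_lt_add, Int.floor_lt, Finset.prod_range_succ]
  push_cast
  have := Int.lt_floor_add_one ((∏ i ∈ Finset.range k, (m i : ℝ)) * y)
  have hm' : (0 : ℝ) < m k := by exact_mod_cast hm
  nlinarith

/-- The left endpoints of the intervals of a Cantor construction, along the digits of `y`. -/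
noncomputable def cantorEndpoint (m : ℕ → ℕ) (h : ℕ → ℝ) (pick : ℕ → ℝ → ℝ) : ℕ → ℝ → ℝ
  | 0, _ => 0
  | k + 1, y => pick k (cantorEndpoint m h pick k y + mixedDigit m k y * h k)

theorem cantorEndpoint_congr {m : ℕ → ℕ} {h : ℕ → ℝ} {pick : ℕ → ℝ → ℝ} {y z : ℝ} {k : ℕ}
    (hyz : ∀ i ≤ k, ⌊(∏ i ∈ Finset.range i, (m i : ℝ)) * y⌋ =
      ⌊(∏ i ∈ Finset.range i, (m i : ℝ)) * z⌋) :
    cantorEndpoint m h pick k y = cantorEndpoint m h pick k z := by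
  induction k with
  | zero => rfl
  | succ k ih =>
    rw [cantorEndpoint, cantorEndpoint, ih fun i hi => hyz i (by omega), mixedDigit, mixedDigit,
      hyz (k + 1) le_rfl, hyz k (by omega)]

/-- A lower bound for the dimension of the points that are close to a point of `P k` for every
`k`, if there is a Cantor construction in which an interval of length `r k` has `m k` cells of
length `h k`, and every cell has a point of `P k` in its first third. -/
theorem le_dimH_of_cantor {r h : ℕ → ℝ} {m : ℕ → ℕ} {P : ℕ → Set ℝ} {s : ℝ}
    (hs0 : 0 < s) (hs1 : s ≤ 1) (hr : ∀ k, 0 < r k) (hr0 : r 0 ≤ 1) (hh : ∀ k, 0 < h k)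
    (hm : ∀ k, 2 ≤ m k) (hmr : ∀ k, m k * h k ≤ r k) (hrm : ∀ k, r k ≤ 2 * (m k * h k))
    (hrh : ∀ k, r (k + 1) ≤ h k / 3)
    (hP : ∀ k z, 0 ≤ z → z + h k / 3 ≤ 1 → ∃ p ∈ P k, z ≤ p ∧ p ≤ z + h k / 3)
    (hM : ∀ k, 1 / 2 ≤ (∏ i ∈ Finset.range k, (m i : ℝ)) * r k ^ s) :
    ENNReal.ofReal s ≤
      dimH {x | x ∈ Icc (0 : ℝ) 1 ∧ ∀ k, ∃ p ∈ P k, p ≤ x ∧ x ≤ p + r (k + 1)} := by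
  choose! pick hpick using hP
  set a := cantorEndpoint m h pick with ha
  set M : ℕ → ℝ := fun k => ∏ i ∈ Finset.range k, (m i : ℝ) with hMdef
  have hm0 : ∀ k, (2 : ℝ) ≤ m k := fun k => by exact_mod_cast hm k
  have hMpos : ∀ k, 0 < M k := fun k => Finset.prod_pos fun i _ => by linarith [hm0 i]
  have hd0 : ∀ k y, (0 : ℝ) ≤ mixedDigit m k y := fun k y => by
    exact_mod_cast mixedDigit_nonneg m k y
  have hd1 : ∀ k y, (mixedDigit m k y : ℝ) + 1 ≤ m k := fun k y => by
    have := mixedDigit_lt m k y (by have := hm k; omega)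
    exact_mod_cast this
  have hdh : ∀ k y, (mixedDigit m k y : ℝ) * h k + h k ≤ r k := fun k y => by
    nlinarith [hd1 k y, hmr k, hh k]
  have hdh0 : ∀ k y, 0 ≤ (mixedDigit m k y : ℝ) * h k := fun k y =>
    mul_nonneg (hd0 k y) (hh k).le
  have hbound : ∀ k y, 0 ≤ a k y ∧ a k y + r k ≤ 1 := by
    intro k y
    induction k with
    | zero => exact ⟨le_rfl, by simpa [ha, cantorEndpoint] using hr0⟩
    | succ k ih =>
      have h1 := hpick k (a k y + mixedDigit m k y * h k)
        (by linarith [hdh0 k y]) (by linarith [hdh k y, hh k])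
      have h2 : a (k + 1) y = pick k (a k y + mixedDigit m k y * h k) := rfl
      rw [h2]
      constructor <;> linarith [h1.2.1, h1.2.2, hdh0 k y, hdh k y, hrh k, hh k]
  have hstep : ∀ k y, a (k + 1) y ∈ P k ∧ a k y + mixedDigit m k y * h k ≤ a (k + 1) y ∧
      a (k + 1) y ≤ a k y + mixedDigit m k y * h k + h k / 3 := fun k y =>
    hpick k (a k y + mixedDigit m k y * h k) (by linarith [hdh0 k y, hbound k y])
      (by linarith [hdh k y, hh k, hbound k y])
  have hmono : ∀ y, Monotone fun k => a k y := fun y =>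
    monotone_nat_of_le_succ fun k => by linarith [hstep k y, hdh0 k y]
  have hanti : ∀ y, Antitone fun k => a k y + r k := fun y =>
    antitone_nat_of_succ_le fun k => by
      linarith [hstep k y, hdh k y, hrh k, hh k]
  have hlim : ∀ y, ∃ x, ∀ k, a k y ≤ x ∧ x ≤ a k y + r k := by
    intro y
    have hle : ∀ i k, a i y ≤ a k y + r k := fun i k =>
      (hmono y (le_max_left i k)).trans <| by
        have := hanti y (le_max_right i k)
        simp only at this
        linarith [hr (max i k)]
    refine ⟨⨆ k, a k y, fun k => ⟨le_ciSup (f := fun k => a k y) ⟨a 0 y + r 0, ?_⟩ k,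
      ciSup_le fun i => hle i k⟩⟩
    rintro _ ⟨i, rfl⟩
    exact hle i 0
  choose x hx using hlim
  have hMlt : ∀ k, (2 : ℝ) ^ k ≤ M k := by
    intro k
    induction k with
    | zero => simp [hMdef]
    | succ k ih =>
      rw [pow_succ, show M (k + 1) = M k * m k from Finset.prod_range_succ _ _]
      exact mul_le_mul ih (hm0 k) (by norm_num) (hMpos k).le
  have hkey : ∀ y ∈ Ico (0 : ℝ) 1, ∀ z ∈ Ico (0 : ℝ) 1, y < z →
      z - y ≤ 24 * |x z - x y| ^ s := by
    intro y hy z hz hyz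
    have hex : ∃ k, ⌊M k * y⌋ ≠ ⌊M k * z⌋ := by
      obtain ⟨k, hk⟩ := pow_unbounded_of_one_lt (1 / (z - y)) (one_lt_two (α := ℝ))
      refine ⟨k, fun heq => ?_⟩
      have h1 := Int.lt_floor_add_one (M k * z)
      have h2 := Int.floor_le (M k * y)
      rw [heq] at h2
      have h3 : 1 / (z - y) < M k := hk.trans_le (hMlt k)
      rw [div_lt_iff₀ (by linarith)] at h3
      linarith
    classical
    -- Both floors vanish at level `0`, so the first disagreement comes later.
    obtain ⟨k, hk⟩ : ∃ k, Nat.find hex = k + 1 := by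
      refine Nat.exists_eq_succ_of_ne_zero fun h0 => ?_
      have := Nat.find_spec hex
      rw [h0] at this
      simp only [hMdef, Finset.range_zero, Finset.prod_empty, one_mul] at this
      rw [Int.floor_eq_zero_iff.2 hy, Int.floor_eq_zero_iff.2 hz] at this
      exact this rfl
    have hne := Nat.find_spec hex
    rw [hk] at hne
    have heq : ∀ i ≤ k, ⌊M i * y⌋ = ⌊M i * z⌋ := fun i hi => by
      simpa using Nat.find_min hex (m := i) (by omega)
    have haeq : a k y = a k z := cantorEndpoint_congr heq
    have hdiff : mixedDigit m k z - mixedDigit m k y = ⌊M (k + 1) * z⌋ - ⌊M (k + 1) * y⌋ := by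
      have := heq k le_rfl
      simp only [mixedDigit, hMdef] at this ⊢
      rw [this]; ring
    have hfl : ⌊M (k + 1) * y⌋ < ⌊M (k + 1) * z⌋ :=
      lt_of_le_of_ne (Int.floor_mono (mul_le_mul_of_nonneg_left hyz.le (hMpos _).le)) hne
    set Δ : ℝ := (mixedDigit m k z : ℝ) - mixedDigit m k y with hΔ
    have hΔ' : Δ = (⌊M (k + 1) * z⌋ : ℝ) - ⌊M (k + 1) * y⌋ := by
      rw [hΔ]; exact_mod_cast hdiff
    have hΔ1 : 1 ≤ Δ := by
      rw [hΔ']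
      have : (⌊M (k + 1) * y⌋ : ℝ) + 1 ≤ ⌊M (k + 1) * z⌋ := by exact_mod_cast hfl
      linarith
    have hΔm : Δ ≤ m k := by linarith [hd1 k z, hd0 k y]
    have hyzM : M (k + 1) * (z - y) ≤ 2 * Δ := by
      have h1 := Int.lt_floor_add_one (M (k + 1) * z)
      have h2 := Int.floor_le (M (k + 1) * y)
      linarith
    -- The picked points cost at most `h k / 3` and the next interval at most another `h k / 3`,
    -- leaving a third since `Δ ≥ 1`.
    have hxx : Δ * (h k / 3) ≤ x z - x y := by
      have h1 := (hx y (k + 1)).2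
      have h2 := (hx z (k + 1)).1
      have h3 := (hstep k y).2.2
      have h4 := (hstep k z).2.1
      have h5 : (mixedDigit m k z : ℝ) * h k - mixedDigit m k y * h k = Δ * h k := by
        rw [hΔ]; ring
      nlinarith [hrh k, hh k]
    have hmk : (0 : ℝ) < m k := by linarith [hm0 k]
    have hq0 : 0 < Δ / m k := by positivity
    have hq1 : Δ / m k ≤ 1 := (div_le_one hmk).2 hΔm
    have hqr : Δ / m k * r k ≤ 6 * (x z - x y) := by
      rw [div_mul_eq_mul_div, div_le_iff₀ hmk]
      nlinarith [hrm k, mul_le_mul_of_nonneg_left (hrm k) (by linarith : 0 ≤ Δ)]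
    have hxpos : 0 ≤ x z - x y := le_trans (by have := hh k; positivity) hxx
    have h6 : (6 : ℝ) ^ s ≤ 6 := by
      simpa using Real.rpow_le_rpow_of_exponent_le (by norm_num : (1 : ℝ) ≤ 6) hs1
    have hMs : M (k + 1) = M k * m k := Finset.prod_range_succ _ _
    have h7 : z - y ≤ 2 * (Δ / m k) / M k := by
      rw [le_div_iff₀ (hMpos k), ← mul_div_assoc, le_div_iff₀ hmk]
      rw [hMs] at hyzM
      linarith
    have h8 : 1 / M k ≤ 2 * r k ^ s := by
      rw [div_le_iff₀ (hMpos k)]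
      have := hM k
      simp only [hMdef]
      linarith
    -- This interpolates inside one level: the mass bound `hM` controls only `1 / M k`, and the
    -- proportion `Δ / m k ≤ 1` supplies the rest.
    have h9 : Δ / m k ≤ (Δ / m k) ^ s := by
      simpa using Real.rpow_le_rpow_of_exponent_ge hq0 hq1 hs1
    rw [abs_of_nonneg hxpos]
    calc z - y ≤ 2 * (Δ / m k) / M k := h7
      _ = 2 * ((Δ / m k) * (1 / M k)) := by ring
      _ ≤ 2 * ((Δ / m k) ^ s * (2 * r k ^ s)) := by
          have := (hMpos k).le
          gcongr
      _ = 4 * (Δ / m k * r k) ^ s := by rw [Real.mul_rpow hq0.le (hr k).le]; ring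
      _ ≤ 4 * (6 * (x z - x y)) ^ s := by
          have := (hr k).le
          gcongr
      _ = 4 * (6 ^ s * (x z - x y) ^ s) := by rw [Real.mul_rpow (by norm_num) hxpos]
      _ ≤ 4 * (6 * (x z - x y) ^ s) := by gcongr
      _ = 24 * (x z - x y) ^ s := by ring
  have hkey' : ∀ y ∈ Ico (0 : ℝ) 1, ∀ z ∈ Ico (0 : ℝ) 1, |y - z| ≤ 24 * |x y - x z| ^ s := by
    intro y hy z hz
    rcases lt_trichotomy y z with hlt | rfl | hlt
    · rw [abs_sub_comm y z, abs_sub_comm (x y), abs_of_pos (by linarith)]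
      exact hkey y hy z hz hlt
    · simp [Real.zero_rpow hs0.ne']
    · rw [abs_of_pos (by linarith)]
      exact hkey z hz y hy hlt
  have hinj : InjOn x (Ico 0 1) := by
    intro y hy z hz hxy
    have := hkey' y hy z hz
    rw [hxy, sub_self, abs_zero, Real.zero_rpow hs0.ne', mul_zero] at this
    exact sub_eq_zero.1 (abs_eq_zero.1 (le_antisymm this (abs_nonneg _)))
  set g := Function.invFunOn x (Ico 0 1) with hg
  have hgx : ∀ y ∈ Ico (0 : ℝ) 1, g (x y) = y := fun y hy => hinj.leftInvOn_invFunOn hy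
  have hholder : HolderOnWith 24 s.toNNReal g (x '' Ico 0 1) := by
    rintro _ ⟨y, hy, rfl⟩ _ ⟨z, hz, rfl⟩
    rw [hgx y hy, hgx z hz, edist_dist, edist_dist, Real.dist_eq, Real.dist_eq,
      Real.coe_toNNReal s hs0.le, ENNReal.ofReal_rpow_of_nonneg (abs_nonneg _) hs0.le,
      show ((24 : NNReal) : ENNReal) = ENNReal.ofReal 24 by simp,
      ← ENNReal.ofReal_mul (by norm_num)]
    exact ENNReal.ofReal_le_ofReal (hkey' y hy z hz)
  have himage : g '' (x '' Ico 0 1) = Ico 0 1 := by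
    rw [image_image, image_congr hgx, image_id']
  have hdim := hholder.dimH_image_le (Real.toNNReal_pos.2 hs0)
  rw [himage, Real.dimH_of_nonempty_interior (by simp [interior_Ico]), Module.finrank_self,
    ENNReal.le_div_iff_mul_le (by simp [hs0]) (by simp), Nat.cast_one, one_mul] at hdim
  refine hdim.trans (dimH_mono ?_)
  rintro _ ⟨y, -, rfl⟩
  refine ⟨⟨(hbound 0 y).1.trans (hx y 0).1, (hx y 0).2.trans (hbound 0 y).2⟩, fun k =>
    ⟨a (k + 1) y, (hstep k y).1, hx y (k + 1)⟩⟩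

/-! ### Discrepancy and empty intervals -/

/-- An interval missed by the first `N` terms contributes its whole length to the supremum. -/
theorem exists_mem_Ico_of_discrepancy_lt {ω : ℕ → ℝ} {N : ℕ} {a b : ℝ} (ha : 0 ≤ a)
    (hab : a < b) (hb : b ≤ 1) (hD : discrepancy ω N < b - a) :
    ∃ j, 1 ≤ j ∧ j ≤ N ∧ ω j ∈ Ico a b := by
  by_contra! hne
  have hcount : countingFn (Ico a b) N ω = 0 := by
    rw [countingFn, eq_empty_of_forall_notMem (s := {j : ℕ | _}) fun j hj =>
      hne j hj.1 hj.2.1 hj.2.2, ncard_empty]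
  have h1 := le_csSup (discrepancy_bddAbove ω N) (mem_image_of_mem _
    (show Ico a b ∈ unitRectangles from
      ⟨a, ⟨ha, by linarith⟩, b, ⟨by linarith, hb⟩, hab, rfl⟩))
  rw [hcount, Real.volume_real_Ico_of_le hab.le, Nat.cast_zero, zero_div, zero_sub, abs_neg,
    abs_of_pos (sub_pos.2 hab)] at h1
  exact absurd hD (not_lt.2 h1)

/-! ### Upper bound by covering -/

theorem dimH_approxSet_rpow_le (ω : ℕ → ℝ) {τ : ℝ} (hτ : 0 < τ) :
    dimH (approxSet ω (fun N : ℕ => (N : ℝ) ^ (-τ))) ≤ ENNReal.ofReal (1 / τ) := by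
  refine dimH_le fun d hd => ?_
  by_contra! hlt
  have hdτ : 1 < τ * d := by
    rw [ENNReal.ofReal_lt_iff_lt_toReal (by positivity) (by simp), div_lt_iff₀ hτ] at hlt
    simpa [mul_comm] using hlt
  set f : ℕ → ENNReal := fun j => ENNReal.ofReal (2 ^ (d : ℝ) * (j : ℝ) ^ (-(τ * d))) with hf
  have hsum : ∑' j, f j ≠ ⊤ := by
    have h := (Real.summable_nat_rpow (p := -(τ * d))).2 (by linarith)
    exact (h.mul_left (2 ^ (d : ℝ))).tsum_ofReal_ne_top
  have hdiam : ∀ j : ℕ, Metric.ediam (Metric.ball (ω j) ((j : ℝ) ^ (-τ))) ≤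
      ENNReal.ofReal (2 * (j : ℝ) ^ (-τ)) := fun j => by
    rw [Real.ball_eq_Ioo, Real.ediam_Ioo]
    exact ENNReal.ofReal_le_ofReal (by linarith)
  have hpow : ∀ j : ℕ, ENNReal.ofReal (2 * (j : ℝ) ^ (-τ)) ^ (d : ℝ) = f j := fun j => by
    rw [ENNReal.ofReal_rpow_of_nonneg (by positivity) d.coe_nonneg, Real.mul_rpow (by norm_num)
      (by positivity), ← Real.rpow_mul (Nat.cast_nonneg j), neg_mul]
  have hzero : Tendsto (fun n : ℕ => ENNReal.ofReal (2 * ((n + 1 : ℕ) : ℝ) ^ (-τ))) atTop (𝓝 0) := by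
    simpa using ENNReal.tendsto_ofReal (((tendsto_rpow_neg_atTop hτ).comp
      (tendsto_natCast_atTop_atTop.comp (tendsto_add_atTop_nat 1))).const_mul 2)
  have hle := Measure.hausdorffMeasure_le_liminf_tsum (d : ℝ)
    (approxSet ω (fun N : ℕ => (N : ℝ) ^ (-τ))) _ hzero
    (fun (n i : ℕ) => Metric.ball (ω (i + (n + 1))) (((i + (n + 1) : ℕ) : ℝ) ^ (-τ)))
    (Eventually.of_forall fun n i => (hdiam _).trans <| ENNReal.ofReal_le_ofReal <| by
      have : ((n + 1 : ℕ) : ℝ) ≤ ((i + (n + 1) : ℕ) : ℝ) := by exact_mod_cast Nat.le_add_left _ _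
      have h2 := Real.rpow_le_rpow_of_nonpos (by positivity) this (by linarith : -τ ≤ 0)
      linarith)
    (Eventually.of_forall fun n x hx => by
      obtain ⟨j, hj, hnj⟩ := hx.2.exists_gt n
      refine mem_iUnion.2 ⟨j - (n + 1), ?_⟩
      rw [Nat.sub_add_cancel hnj]
      exact hj.2)
  rw [hd, top_le_iff] at hle
  have hlim : Tendsto (fun n : ℕ => ∑' i : ℕ,
      Metric.ediam (Metric.ball (ω (i + (n + 1))) (((i + (n + 1) : ℕ) : ℝ) ^ (-τ))) ^ (d : ℝ))
      atTop (𝓝 0) := by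
    refine tendsto_of_tendsto_of_tendsto_of_le_of_le tendsto_const_nhds
      ((ENNReal.tendsto_sum_nat_add f hsum).comp (tendsto_add_atTop_nat 1))
      (fun _ => zero_le) fun n => ENNReal.tsum_le_tsum fun i => ?_
    rw [← hpow]
    exact ENNReal.rpow_le_rpow (hdiam _) d.coe_nonneg
  rw [hlim.liminf_eq] at hle
  exact ENNReal.zero_ne_top hle

/-! ### Lower bound -/

/-- Points that are within `ψ (n k)` of one of `ω 1, …, ω (n k)` for every `k`, with `n k → ∞`,
lie in `approxSet ω ψ` or are terms of the sequence. -/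
theorem mem_approxSet_or_mem_range {ω ψ : ℕ → ℝ} (hψ : AntitoneOn ψ (Ici 1))
    (hψ0 : Tendsto ψ atTop (𝓝 0)) {n : ℕ → ℕ} (hn : Tendsto n atTop atTop) {x : ℝ}
    (hx : x ∈ Icc (0 : ℝ) 1) (h : ∀ k, ∃ j, 1 ≤ j ∧ j ≤ n k ∧ |x - ω j| < ψ (n k)) :
    x ∈ approxSet ω ψ ∪ range ω := by
  choose j hj1 hjn hj using h
  -- If the indices take finitely many values, one recurs and `ψ (n k) → 0` forces `x` to be that
  -- term. Otherwise `ψ (n k) ≤ ψ (j k)` gives infinitely many approximations.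
  by_cases hfin : (range j).Finite
  · right
    obtain ⟨i, hi⟩ : ∃ i, ∃ᶠ k in atTop, j k = i := by
      by_contra! hcon
      have hall := (hfin.eventually_all (l := atTop) (p := fun i k => j k ≠ i)).2 fun i _ => by
        simpa using hcon i
      obtain ⟨k, hk⟩ := hall.exists
      exact hk (j k) (mem_range_self k) rfl
    refine ⟨i, (sub_eq_zero.1 (abs_eq_zero.1 (le_antisymm ?_ (abs_nonneg _)))).symm⟩
    exact ge_of_tendsto_of_frequently (hψ0.comp hn)
      (hi.mono fun k hk => by rw [← hk]; exact (hj k).le)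
  · left
    refine ⟨hx, Set.Infinite.mono ?_ hfin⟩
    rintro _ ⟨k, rfl⟩
    exact ⟨hj1 k, (hj k).trans_le (hψ (hj1 k) ((hj1 k).trans (hjn k)) (hjn k))⟩

theorem le_dimH_approxSet_rpow {ω : ℕ → ℝ} {C : ℝ} (hC : 0 < C)
    (hD : {N : ℕ | 1 ≤ N ∧ discrepancy ω N ≤ C * (1 / (N : ℝ))}.Infinite)
    {τ s : ℝ} (hτ : 1 < τ) (hs0 : 0 < s) (hs : s * τ < 1) :
    ENNReal.ofReal s ≤ dimH (approxSet ω (fun N : ℕ => (N : ℝ) ^ (-τ))) := by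
  -- With `K > C`, a third of a cell, `K / n (k + 1)`, strictly exceeds the discrepancy.
  set K : ℝ := C + 1 with hK
  have hK1 : 1 ≤ K := by linarith
  have hs1 : s ≤ 1 := by nlinarith
  -- Halving turns `x ≤ p + r (k + 1)` into the strict inequality of `approxSet`.
  set ρ : ℕ → ℝ := fun n => (n : ℝ) ^ (-τ) / 2 with hρ
  have hρpos : ∀ n : ℕ, 1 ≤ n → 0 < ρ n := fun n hn => by
    have : (0 : ℝ) < n := by exact_mod_cast hn
    positivity
  -- The last two conditions leave room for two cells and let the slack `1 - s * τ > 0` absorb the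
  -- previous scale.
  have hnext : ∀ n : ℕ, 1 ≤ n → ∃ n' : ℕ, 1 ≤ n' ∧ n < n' ∧
      discrepancy ω n' ≤ C * (1 / (n' : ℝ)) ∧ 2 * (3 * K / n') ≤ ρ n ∧
      1 ≤ ρ n / (6 * K) * (n' : ℝ) ^ (1 - s * τ) := by
    intro n hn
    have hpos := hρpos n hn
    have h1 : ∀ᶠ n' : ℕ in atTop, 2 * (3 * K / n') ≤ ρ n := by
      have : Tendsto (fun n' : ℕ => 2 * (3 * K / (n' : ℝ))) atTop (𝓝 (2 * 0)) :=
        (tendsto_const_div_atTop_nhds_zero_nat (3 * K)).const_mul 2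
      rw [mul_zero] at this
      exact this.eventually_le_const hpos
    have h2 : ∀ᶠ n' : ℕ in atTop, 1 ≤ ρ n / (6 * K) * (n' : ℝ) ^ (1 - s * τ) :=
      (((tendsto_rpow_atTop (by linarith : 0 < 1 - s * τ)).comp
        tendsto_natCast_atTop_atTop).const_mul_atTop (by positivity)).eventually_ge_atTop 1
    obtain ⟨n', hn', h3, h4, h5⟩ := ((Nat.frequently_atTop_iff_infinite.2 hD).and_eventually
      ((eventually_gt_atTop n).and (h1.and h2))).exists
    exact ⟨n', hn'.1, h3, hn'.2, h4, h5⟩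
  choose! next hnext1 hlt hdisc hsmall hlarge using hnext
  set n : ℕ → ℕ := fun k => next^[k] 1 with hn
  have hsucc : ∀ k, n (k + 1) = next (n k) := fun k => Function.iterate_succ_apply' _ _ _
  have hn1 : ∀ k, 1 ≤ n k := by
    intro k
    induction k with
    | zero => exact le_rfl
    | succ k ih => rw [hsucc]; exact hnext1 _ ih
  have hnmono : StrictMono n := strictMono_nat_of_lt_succ fun k => by
    rw [hsucc]; exact hlt _ (hn1 k)
  have hnpos : ∀ k, (0 : ℝ) < n k := fun k => by exact_mod_cast hn1 k
  set h : ℕ → ℝ := fun k => 3 * K / n (k + 1) with hh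
  have hhpos : ∀ k, 0 < h k := fun k => by have := hnpos (k + 1); positivity
  set m : ℕ → ℕ := fun k => ⌊ρ (n k) / h k⌋₊ with hm
  have hrk : ∀ k, 0 < ρ (n k) := fun k => hρpos _ (hn1 k)
  have h2h : ∀ k, 2 * h k ≤ ρ (n k) := fun k => by
    simp only [hh, hsucc]; exact hsmall _ (hn1 k)
  have hm2 : ∀ k, 2 ≤ m k := fun k => by
    rw [Nat.le_floor_iff (by have := hhpos k; have := hrk k; positivity), le_div_iff₀ (hhpos k)]
    exact_mod_cast h2h k
  have hmr : ∀ k, m k * h k ≤ ρ (n k) := fun k => by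
    rw [← le_div_iff₀ (hhpos k)]
    exact Nat.floor_le (by have := hhpos k; have := hrk k; positivity)
  have hrm : ∀ k, ρ (n k) ≤ 2 * (m k * h k) := fun k => by
    have h1 := Nat.lt_floor_add_one (ρ (n k) / h k)
    rw [div_lt_iff₀ (hhpos k)] at h1
    change ρ (n k) < ((m k : ℝ) + 1) * h k at h1
    nlinarith [h2h k]
  have hhalf : ∀ c : ℝ, 0 ≤ c → c ^ s / 2 ≤ (c / 2) ^ s := fun c hc => by
    rw [Real.div_rpow hc (by norm_num)]
    have : (2 : ℝ) ^ s ≤ 2 := by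
      simpa using Real.rpow_le_rpow_of_exponent_le (by norm_num : (1 : ℝ) ≤ 2) hs1
    gcongr
  have hρ0 : ρ (n 0) = 1 / 2 := by simp [hρ, hn]
  have hcantor := le_dimH_of_cantor (r := fun k => ρ (n k)) (h := h) (m := m)
    (P := fun k => {p | ∃ j, 1 ≤ j ∧ j ≤ n (k + 1) ∧ ω j = p}) hs0 hs1 hrk
    (by rw [hρ0]; norm_num) hhpos hm2 hmr hrm ?_ ?_ ?_
  · refine hcantor.trans ((dimH_mono (t := approxSet ω (fun N : ℕ => (N : ℝ) ^ (-τ)) ∪ range ω)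
      ?_).trans_eq ?_)
    · rintro x ⟨hx, hxk⟩
      refine mem_approxSet_or_mem_range (n := fun k => n (k + 1)) ?_ ?_
        (hnmono.tendsto_atTop.comp (tendsto_add_atTop_nat 1)) hx fun k => ?_
      · intro i hi j _ hij
        exact Real.rpow_le_rpow_of_nonpos (by exact_mod_cast hi) (by exact_mod_cast hij)
          (by linarith)
      · exact (tendsto_rpow_neg_atTop (by linarith)).comp tendsto_natCast_atTop_atTop
      · obtain ⟨_, ⟨j, hj1, hjn, rfl⟩, h1, h2⟩ := hxk k
        refine ⟨j, hj1, hjn, ?_⟩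
        rw [abs_of_nonneg (by linarith)]
        have := hrk (k + 1)
        simp only [hρ] at h2 this
        linarith
    -- The exceptional points are countable, hence of dimension zero.
    · rw [dimH_union, dimH_countable (countable_range ω), max_eq_left zero_le]
  · intro k
    have h1 : (n (k + 1) : ℝ) ^ (-τ) ≤ (n (k + 1) : ℝ) ^ (-1 : ℝ) :=
      Real.rpow_le_rpow_of_exponent_le (by exact_mod_cast hn1 (k + 1)) (by linarith)
    rw [Real.rpow_neg_one] at h1
    have h2 : h k / 3 = K * (n (k + 1) : ℝ)⁻¹ := by simp only [hh]; field_simp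
    have h3 : (0 : ℝ) < (n (k + 1) : ℝ)⁻¹ := inv_pos.2 (hnpos _)
    rw [h2]
    simp only [hρ]
    nlinarith
  · intro k z hz hz1
    have hlt' : discrepancy ω (n (k + 1)) < z + h k / 3 - z := by
      have h1 : discrepancy ω (n (k + 1)) ≤ C * (1 / (n (k + 1) : ℝ)) := by
        rw [hsucc]; exact hdisc _ (hn1 k)
      have h2 : h k / 3 = K * (1 / (n (k + 1) : ℝ)) := by simp only [hh]; field_simp
      have h3 : (0 : ℝ) < 1 / (n (k + 1) : ℝ) := one_div_pos.2 (hnpos _)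
      rw [h2]
      nlinarith
    obtain ⟨j, hj1, hjn, hj⟩ := exists_mem_Ico_of_discrepancy_lt hz
      (by linarith [hhpos k]) hz1 hlt'
    exact ⟨ω j, ⟨j, hj1, hjn, rfl⟩, hj.1, hj.2.le⟩
  · intro k
    cases k with
    | zero =>
      have := hhalf 1 zero_le_one
      rw [hρ0]
      simpa using this
    | succ k =>
      clear_value m n
      -- The last radix alone provides the needed mass, so earlier ones are bounded below by `1`.
      have hM1 : 1 ≤ ∏ i ∈ Finset.range k, (m i : ℝ) := Finset.one_le_prod fun i _ => by
        exact_mod_cast (by have := hm2 i; omega : 1 ≤ m i)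
      have hq : ρ (n k) / (6 * K) * n (k + 1) ≤ m k := by
        have h1 := hrm k
        simp only [hh] at h1
        have h2 := hnpos (k + 1)
        rw [div_mul_eq_mul_div, div_le_iff₀ (by positivity)]
        have h3 : 2 * ((m k : ℝ) * (3 * K / n (k + 1))) = m k * (6 * K) / n (k + 1) := by ring
        rw [h3, le_div_iff₀ h2] at h1
        exact h1
      have hpow : ((n (k + 1) : ℝ) ^ (-τ)) ^ s = (n (k + 1) : ℝ) ^ (1 - s * τ) / n (k + 1) := by
        rw [← Real.rpow_mul (hnpos _).le, Real.rpow_sub (hnpos _), Real.rpow_one,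
          neg_mul, mul_comm τ, Real.rpow_neg (hnpos _).le]
        have := (hnpos (k + 1)).ne'
        field_simp
      have hl : 1 ≤ ρ (n k) / (6 * K) * (n (k + 1) : ℝ) ^ (1 - s * τ) := by
        rw [hsucc]; exact hlarge _ (hn1 k)
      have hhf := hhalf ((n (k + 1) : ℝ) ^ (-τ)) (by positivity)
      rw [hpow] at hhf
      have h2 := hnpos (k + 1)
      have h3 := hrk k
      rw [Finset.prod_range_succ]
      have hMm : ρ (n k) / (6 * K) * n (k + 1) ≤ (∏ i ∈ Finset.range k, (m i : ℝ)) * m k :=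
        hq.trans (le_mul_of_one_le_left (Nat.cast_nonneg _) hM1)
      refine le_trans ?_ (mul_le_mul hMm hhf (by positivity) (by positivity))
      have hcancel : ∀ A B c : ℝ, 0 < c → A * c * (B / c / 2) = A * B / 2 := fun A B c hc => by
        field_simp
      rw [hcancel _ _ _ h2]
      gcongr

theorem mainTheorem5 (ω : ℕ → ℝ) (hω : IsUniformlyDistributed ω)
    (hD : ∃ C : ℝ, 0 < C ∧ {N : ℕ | 1 ≤ N ∧ discrepancy ω N ≤ C * (1 / (N : ℝ))}.Infinite)
    (τ : ℝ) (hτ : 1 < τ) :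
    dimH (approxSet ω (fun N : ℕ => (N : ℝ) ^ (-τ))) = ENNReal.ofReal (1 / τ) := by
  obtain ⟨C, hC, hD⟩ := hD
  refine le_antisymm (dimH_approxSet_rpow_le ω (by linarith)) (le_of_forall_lt fun c hc => ?_)
  obtain ⟨d, hcd, hd⟩ := ENNReal.lt_iff_exists_nnreal_btwn.1 hc
  refine hcd.trans_le ?_
  rw [ENNReal.lt_ofReal_iff_toReal_lt (by simp), lt_div_iff₀ (by linarith)] at hd
  rw [← ENNReal.ofReal_coe_nnreal]
  refine le_dimH_approxSet_rpow hC hD hτ (NNReal.coe_pos.2 ?_) hd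
  exact_mod_cast pos_of_gt hcd
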